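/- Proposition 3.2. All rings are associative with unit, and modules are left modules. Let $R\subset A$ be a Frobenius extension of rings, that is, $R$ is a subring of $A$ (via an injective unital ring homomorphism $\iota:R\to A$) and there are an $R$-$R$-bimodule homomorphism $\tau:A\to R$ and finitely many elements $x_i,y_i\in A$ such that $\sum_i x_i\,\tau(y_i a)=a=\sum_i\tau(a x_i)\,y_i$ for all $a\in A$. Let $M$ be any left $A$-module. Then $$\mathrm{G\text{-}proj.dim}_R M=\mathrm{G\text{-}proj.dim}_A(A\otimes_R M)=\mathrm{G\text{-}proj.dim}_R(A\otimes_R M)$$ and $$\mathrm{G\text{-}inj.dim}_R M=\mathrm{G\text{-}inj.dim}_A(A\otimes_R M)=\mathrm{G\text{-}inj.dim}_R(A\otimes_R M),$$ where the values may be infinite and $A$-modules are regarded as $R$-modules by restriction of scalars. Here a module $M$ over a ring $\Lambda$ is Gorenstein projective if $M\cong\mathrm{Ker}(P_0\to P_{-1})$ for an exact complex $\cdots\to P_1\to P_0\to P_{-1}\to\cdots$ of projective $\Lambda$-modules that stays exact under $\mathrm{Hom}_\Lambda(-,Q)$ for every projective $\Lambda$-module $Q$; and Gorenstein injective if $M\cong\mathrm{Ker}(I_0\to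 I_{-1})$ for an exact complex $\cdots\to I_1\to I_0\to I_{-1}\to\cdots$ of injective $\Lambda$-modules that stays exact under $\mathrm{Hom}_\Lambda(J,-)$ for every injective $\Lambda$-module $J$. The Gorenstein projective dimension $\mathrm{G\text{-}proj.dim}_\Lambda M\in\mathbb{N}\cup\{\infty\}$ is the least $n\in\mathbb N$ for which there is an exact sequence $0\to G_n\to\cdots\to G_0\to M\to 0$ with all $G_i$ Gorenstein projective, and $\infty$ if there is none; the Gorenstein injective dimension $\mathrm{G\text{-}inj.dim}_\Lambda M$ is the least $n\in\mathbb N$ for which there is an exact sequence $0\to M\to G^0\to\cdots\to G^n\to 0$ with all $G^i$ Gorenstein injective, and $\infty$ if there is none. -/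

import Mathlib

open CategoryTheory CategoryTheory.Limits
open scoped TensorProduct

universe u v w

/-! ### Gorenstein projective and Gorenstein injective objects -/

section Gorenstein

variable {C : Type u} [Category.{v} C] [Abelian C]

/-- A totally acyclic complex of projectives: an exact complex `⋯ ⟶ P₁ ⟶ P₀ ⟶ P₋₁ ⟶ ⋯` of
projective objects such that `Hom(P, Q)` is exact for every projective object `Q`. -/
structure IsTotallyAcyclicProjective (P : ChainComplex C ℤ) : Prop where
  projective : ∀ i, Projective (P.X i)
  exact : P.Acyclic
  /-- Exactness of `Hom(P_{i-1}, Q) ⟶ Hom(P_i, Q) ⟶ Hom(P_{i+1}, Q)` at the middle term. -/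
  hom_exact : ∀ Q : C, Projective Q → ∀ (i : ℤ) (f : P.X i ⟶ Q),
    P.d (i + 1) i ≫ f = 0 → ∃ g : P.X (i - 1) ⟶ Q, P.d i (i - 1) ≫ g = f

/-- A totally acyclic complex of injectives: an exact complex `⋯ ⟶ I₁ ⟶ I₀ ⟶ I₋₁ ⟶ ⋯` of
injective objects such that `Hom(J, I)` is exact for every injective object `J`. -/
structure IsTotallyAcyclicInjective (I : ChainComplex C ℤ) : Prop where
  injective : ∀ i, Injective (I.X i)
  exact : I.Acyclic
  /-- Exactness of `Hom(J, I_{i+1}) ⟶ Hom(J, I_i) ⟶ Hom(J, I_{i-1})` at the middle term. -/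
  hom_exact : ∀ J : C, Injective J → ∀ (i : ℤ) (f : J ⟶ I.X i),
    f ≫ I.d i (i - 1) = 0 → ∃ g : J ⟶ I.X (i + 1), g ≫ I.d (i + 1) i = f

/-- `M` is Gorenstein projective: `M ≅ Ker (P₀ ⟶ P₋₁)` for a totally acyclic complex `P` of
projectives. -/
def IsGorensteinProjective (M : C) : Prop :=
  ∃ P : ChainComplex C ℤ, IsTotallyAcyclicProjective P ∧ Nonempty (M ≅ kernel (P.d 0 (-1)))

/-- `M` is Gorenstein injective: `M ≅ Ker (I₀ ⟶ I₋₁)` for a totally acyclic complex `I` of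
injectives. -/
def IsGorensteinInjective (M : C) : Prop :=
  ∃ I : ChainComplex C ℤ, IsTotallyAcyclicInjective I ∧ Nonempty (M ≅ kernel (I.d 0 (-1)))

/-- `M` has a resolution `0 ⟶ Gₙ ⟶ ⋯ ⟶ G₁ ⟶ G₀ ⟶ M ⟶ 0` (an exact sequence) by Gorenstein
projective objects. -/
def HasGorensteinProjectiveResolution (M : C) (n : ℕ) : Prop :=
  ∃ (G : ChainComplex C ℕ) (ε : G.X 0 ⟶ M) (hε : G.d 1 0 ≫ ε = 0),
    (∀ i ≤ n, IsGorensteinProjective (G.X i)) ∧ (∀ i, n < i → IsZero (G.X i)) ∧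
    (∀ i, 0 < i → G.ExactAt i) ∧ (ShortComplex.mk (G.d 1 0) ε hε).Exact ∧ Epi ε

/-- `M` has a coresolution `0 ⟶ M ⟶ G⁰ ⟶ G¹ ⟶ ⋯ ⟶ Gⁿ ⟶ 0` (an exact sequence) by Gorenstein
injective objects. -/
def HasGorensteinInjectiveResolution (M : C) (n : ℕ) : Prop :=
  ∃ (G : CochainComplex C ℕ) (η : M ⟶ G.X 0) (hη : η ≫ G.d 0 1 = 0),
    (∀ i ≤ n, IsGorensteinInjective (G.X i)) ∧ (∀ i, n < i → IsZero (G.X i)) ∧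
    (∀ i, 0 < i → G.ExactAt i) ∧ (ShortComplex.mk η (G.d 0 1) hη).Exact ∧ Mono η

/-- The Gorenstein projective dimension: the least length of a resolution by Gorenstein
projectives, and `⊤` if there is no such resolution of finite length. -/
noncomputable def gorensteinProjectiveDim (M : C) : ℕ∞ :=
  ⨅ (n : ℕ) (_ : HasGorensteinProjectiveResolution M n), (n : ℕ∞)

/-- The Gorenstein injective dimension: the least length of a coresolution by Gorenstein
injectives, and `⊤` if there is no such coresolution of finite length. -/
noncomputable def gorensteinInjectiveDim (M : C) : ℕ∞ :=
  ⨅ (n : ℕ) (_ : HasGorensteinInjectiveResolution M n), (n : ℕ∞)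

end Gorenstein

/-! ### Frobenius extensions and induced modules (for rings that need not be commutative) -/

section Frobenius

variable {R : Type u} {A : Type v} [Ring R] [Ring A]

/-- The injective ring homomorphism `ι : R → A` is a Frobenius extension: there are an
`R`-`R`-bimodule homomorphism `τ : A → R` and finitely many `xᵢ, yᵢ ∈ A` such that
`∑ xᵢ τ(yᵢ a) = a = ∑ τ(a xᵢ) yᵢ` for all `a ∈ A`. -/
structure IsFrobeniusExtension (ι : R →+* A) : Prop where
  injective : Function.Injective ι
  exists_frobenius_system : ∃ τ : A →+ R,
    (∀ (r : R) (a : A) (s : R), τ (ι r * a * ι s) = r * τ a * s) ∧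
    ∃ (n : ℕ) (x y : Fin n → A), ∀ a : A,
      ∑ i, x i * ι (τ (y i * a)) = a ∧ ∑ i, ι (τ (a * x i)) * y i = a

/-- The relations `a ι(r) ⊗ m = a ⊗ r m` in `A ⊗_ℤ M`. -/
def tensorRelations (ι : R →+* A) (M : Type w) [AddCommGroup M] [Module R M] :
    Submodule A (A ⊗[ℤ] M) :=
  Submodule.span A
    {t | ∃ (a : A) (r : R) (m : M), t = (a * ι r) ⊗ₜ[ℤ] m - a ⊗ₜ[ℤ] (r • m)}

/-- The left `A`-module `A ⊗_R M` of a left `R`-module `M`, where `A` is a right `R`-module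
through `ι` and `A` acts by left multiplication on the first factor. (Mathlib's tensor product
over `R` needs `R` to be commutative.) -/
noncomputable def inducedModule (ι : R →+* A) (M : ModuleCat.{w} R) : ModuleCat.{max v w} A :=
  ModuleCat.of A ((A ⊗[ℤ] M) ⧸ tensorRelations ι M)

end Frobenius

/-!
For a Frobenius extension `ι : R → A`, the induction functor `F = A ⊗_R -` is both left and right
adjoint to restriction of scalars `U`: besides the usual adjunction `F ⊣ U` there is an adjunction
`U ⊣ F` with unit `n ↦ ∑ i, xᵢ ⊗ yᵢ n` and counit `a ⊗ m ↦ τ(a) m`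
(`IsFrobeniusExtension.nonempty_restrictInducedAdjunction`). Hence `F` and `U` are exact, preserve
projective objects and carry totally acyclic complexes of projectives to such complexes, because
`Hom(F P, Q) = Hom(P, U Q)` and vice versa. Neither functor increases the Gorenstein projective
dimension (`GorensteinProjectiveDimLE.map`), which gives
`Gpd (U F U M) ≤ Gpd (F U M) ≤ Gpd (U M)`. By the triangle identity `U M` is a direct summand of
`U F U M`, so equality follows once the Gorenstein projective dimension is known not to increase on
passing to direct summands (`GorensteinProjectiveDimLE.of_retract`).

The last fact is proved in any abelian category with enough projectives. Its basis is a coinductive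
description of Gorenstein projective objects (`isGorensteinProjective_iff` and
`IsGorensteinProjective.of_class`): `M` is Gorenstein projective if and only if it belongs to a
class of objects `X` with `Ext¹(X, Q) = 0` for all projective `Q` which contains with each object
some syzygy and some cosyzygy of it. Closure under extensions, direct summands and kernels of
epimorphisms follows by exhibiting suitable classes, and the statement about dimensions by
induction along projective presentations.

The coinductive description also shows that Gorenstein injective objects of `C` are the Gorenstein
projective objects of `Cᵒᵖ` (`isGorensteinInjective_iff_op`), so the injective half of the result
is the projective half for the functors `F.op` and `U.op`, which are again adjoint on both sides.
-/

/-! ### Short exact sequences in an abelian category -/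

section ShortExactSequences

variable {C : Type u} [Category.{v} C] [Abelian C]

/-- The sequence `0 ⟶ X ⟶ Y ⟶ Z ⟶ 0` with maps `f` and `g` is exact. This unbundled form of
`ShortComplex.ShortExact` leaves the relation `f ≫ g = 0` to the proposition. -/
def IsShortExact {X Y Z : C} (f : X ⟶ Y) (g : Y ⟶ Z) : Prop :=
  ∃ w : f ≫ g = 0, (ShortComplex.mk f g w).ShortExact

namespace IsShortExact

variable {X Y Z T : C} {f : X ⟶ Y} {g : Y ⟶ Z}

lemma zero (h : IsShortExact f g) : f ≫ g = 0 := h.1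

lemma mono (h : IsShortExact f g) : Mono f := h.2.mono_f

lemma epi (h : IsShortExact f g) : Epi g := h.2.epi_g

lemma exists_lift (h : IsShortExact f g) (t : T ⟶ Y) (ht : t ≫ g = 0) :
    ∃ l : T ⟶ X, l ≫ f = t := by
  have := h.mono
  exact ⟨h.2.exact.lift t ht, h.2.exact.lift_f t ht⟩

lemma exists_desc (h : IsShortExact f g) (t : Y ⟶ T) (ht : f ≫ t = 0) :
    ∃ l : Z ⟶ T, g ≫ l = t := by
  have := h.epi
  exact ⟨h.2.exact.desc t ht, h.2.exact.g_desc t ht⟩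

lemma of_desc (hf : Mono f) (hg : Epi g) (w : f ≫ g = 0)
    (hd : ∀ (T : C) (t : Y ⟶ T), f ≫ t = 0 → ∃ l : Z ⟶ T, g ≫ l = t) : IsShortExact f g := by
  refine ⟨w, ShortComplex.ShortExact.mk' (ShortComplex.exact_of_g_is_cokernel _ ?_) hf hg⟩
  exact CokernelCofork.IsColimit.ofπ g w (fun t ht => (hd _ t ht).choose)
    (fun t ht => (hd _ t ht).choose_spec) fun t ht b hb => by
      rw [← cancel_epi g, (hd _ t ht).choose_spec, hb]

lemma of_lift (hf : Mono f) (hg : Epi g) (w : f ≫ g = 0)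
    (hl : ∀ (T : C) (t : T ⟶ Y), t ≫ g = 0 → ∃ l : T ⟶ X, l ≫ f = t) : IsShortExact f g := by
  refine ⟨w, ShortComplex.ShortExact.mk' (ShortComplex.exact_of_f_is_kernel _ ?_) hf hg⟩
  exact KernelFork.IsLimit.ofι f w (fun t ht => (hl _ t ht).choose)
    (fun t ht => (hl _ t ht).choose_spec) fun t ht b hb => by
      rw [← cancel_mono f, (hl _ t ht).choose_spec, hb]

lemma of_mono (f : X ⟶ Y) [Mono f] : IsShortExact f (cokernel.π f) :=
  of_desc inferInstance inferInstance (cokernel.condition f)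
    fun _ t ht => ⟨cokernel.desc f t ht, cokernel.π_desc f t ht⟩

lemma of_epi (g : Y ⟶ Z) [Epi g] : IsShortExact (kernel.ι g) g :=
  of_lift inferInstance inferInstance (kernel.condition g)
    fun _ t ht => ⟨kernel.lift g t ht, kernel.lift_ι g t ht⟩

lemma biprod_inl_snd (X Y : C) : IsShortExact (biprod.inl : X ⟶ X ⊞ Y) (biprod.snd : X ⊞ Y ⟶ Y) :=
  of_lift inferInstance inferInstance biprod.inl_snd fun _ t ht =>
    ⟨t ≫ biprod.fst, by ext <;> simp [ht]⟩

lemma biprod_inr_fst (X Y : C) : IsShortExact (biprod.inr : Y ⟶ X ⊞ Y) (biprod.fst : X ⊞ Y ⟶ X) :=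
  of_lift inferInstance inferInstance biprod.inr_fst fun _ t ht =>
    ⟨t ≫ biprod.snd, by ext <;> simp [ht]⟩

lemma iso_comp (h : IsShortExact f g) {X' : C} (e : X' ≅ X) : IsShortExact (e.hom ≫ f) g := by
  have := h.mono
  refine of_lift inferInstance h.epi (by simp [h.zero]) fun T t ht => ?_
  obtain ⟨l, hl⟩ := h.exists_lift t ht
  exact ⟨l ≫ e.inv, by simp [hl]⟩

lemma comp_iso (h : IsShortExact f g) {Z' : C} (e : Z ≅ Z') : IsShortExact f (g ≫ e.hom) := by
  have := h.epi
  refine of_desc h.mono inferInstance (by simp [reassoc_of% h.zero]) fun T t ht => ?_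
  obtain ⟨l, hl⟩ := h.exists_desc t ht
  exact ⟨e.inv ≫ l, by simp [hl]⟩

lemma nonempty_iso_biprod_of_projective (h : IsShortExact f g) (hZ : Projective Z) :
    Nonempty (Y ≅ X ⊞ Z) :=
  have : Projective (ShortComplex.mk f g h.1).X₃ := hZ
  ⟨h.2.splittingOfProjective.isoBinaryBiproduct⟩

lemma map (h : IsShortExact f g) {D : Type*} [Category* D] [Abelian D] (F : C ⥤ D)
    [F.PreservesZeroMorphisms] [PreservesFiniteLimits F] [PreservesFiniteColimits F] :
    IsShortExact (F.map f) (F.map g) :=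
  ⟨_, h.2.map_of_exact F⟩

lemma op (h : IsShortExact f g) : IsShortExact g.op f.op := ⟨_, h.2.op⟩

lemma unop {X Y Z : Cᵒᵖ} {f : X ⟶ Y} {g : Y ⟶ Z} (h : IsShortExact f g) :
    IsShortExact g.unop f.unop := ⟨_, h.2.unop⟩

/-- The pullback of a short exact sequence along a morphism to its last term. -/
lemma pullback (h : IsShortExact f g) {Z' : C} (c : Z' ⟶ Z) :
    IsShortExact (pullback.lift f 0 (by simp [h.zero]) : X ⟶ Limits.pullback g c)
      (pullback.snd g c) := by
  have := h.epi
  have := h.mono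
  refine of_lift ?_ inferInstance (pullback.lift_snd _ _ _) fun T t ht => ?_
  · exact mono_of_mono_fac (pullback.lift_fst f (0 : X ⟶ Z') (by simp [h.zero]))
  · obtain ⟨l, hl⟩ := h.exists_lift (t ≫ pullback.fst g c) (by
      rw [Category.assoc, pullback.condition, reassoc_of% ht, zero_comp])
    refine ⟨l, pullback.hom_ext ?_ ?_⟩
    · rw [Category.assoc, pullback.lift_fst, hl]
    · rw [Category.assoc, pullback.lift_snd, comp_zero, ht]

/-- The pushout of a short exact sequence along a morphism from its first term. -/
lemma pushout (h : IsShortExact f g) {X' : C} (a : X ⟶ X') :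
    IsShortExact (pushout.inr f a)
      (pushout.desc g 0 (by simp [h.zero]) : Limits.pushout f a ⟶ Z) := by
  have := h.epi
  have := h.mono
  refine of_desc inferInstance ?_ (pushout.inr_desc _ _ _) fun T t ht => ?_
  · exact epi_of_epi_fac (pushout.inl_desc g (0 : X' ⟶ Z) (by simp [h.zero]))
  · obtain ⟨l, hl⟩ := h.exists_desc (pushout.inl f a ≫ t) (by
      rw [pushout.condition_assoc, ht, comp_zero])
    refine ⟨l, pushout.hom_ext ?_ ?_⟩
    · rw [pushout.inl_desc_assoc, hl]
    · rw [pushout.inr_desc_assoc, zero_comp, ht]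

/-- Two short exact sequences with the same last term have a common pullback. -/
lemma exists_pullback (h : IsShortExact f g) {X' Y' : C} {f' : X' ⟶ Y'} {g' : Y' ⟶ Z}
    (h' : IsShortExact f' g') :
    ∃ (W : C) (i : X ⟶ W) (p : W ⟶ Y') (i' : X' ⟶ W) (p' : W ⟶ Y),
      IsShortExact i p ∧ IsShortExact i' p' := by
  refine ⟨_, _, _, pullback.lift 0 f' (by simp [h'.zero]), pullback.fst g g', h.pullback g', ?_⟩
  have := h'.epi
  have := h'.mono
  refine of_lift ?_ inferInstance (pullback.lift_fst _ _ _) fun T t ht => ?_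
  · exact mono_of_mono_fac (pullback.lift_snd (0 : X' ⟶ Y) f' (by simp [h'.zero]))
  · obtain ⟨l, hl⟩ := h'.exists_lift (t ≫ pullback.snd g g') (by
      rw [Category.assoc, ← pullback.condition, reassoc_of% ht, zero_comp])
    refine ⟨l, pullback.hom_ext ?_ ?_⟩
    · rw [Category.assoc, pullback.lift_fst, comp_zero, ht]
    · rw [Category.assoc, pullback.lift_snd, hl]

/-- Two short exact sequences with the same first term have a common pushout. -/
lemma exists_pushout (h : IsShortExact f g) {Y' Z' : C} {f' : X ⟶ Y'} {g' : Y' ⟶ Z'}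
    (h' : IsShortExact f' g') :
    ∃ (W : C) (i : Y' ⟶ W) (p : W ⟶ Z) (i' : Y ⟶ W) (p' : W ⟶ Z'),
      IsShortExact i p ∧ IsShortExact i' p' := by
  obtain ⟨W, i, p, i', p', h₁, h₂⟩ := h.op.exists_pullback h'.op
  exact ⟨W.unop, p.unop, i.unop, p'.unop, i'.unop, h₁.unop, h₂.unop⟩

/-- For subobjects `K ⊆ X ⊆ Y`, the quotient `Y / K` is an extension of `Y / X` by `X / K`. -/
lemma exists_quotient (h : IsShortExact f g) {K N : C} {k : K ⟶ X} {a : X ⟶ N}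
    (h' : IsShortExact k a) :
    ∃ (W : C) (p : Y ⟶ W) (i : N ⟶ W) (q : W ⟶ Z),
      IsShortExact (k ≫ f) p ∧ IsShortExact i q ∧ p ≫ q = g := by
  refine ⟨_, pushout.inl f a, _, _, ?_, h.pushout a, pushout.inl_desc _ _ _⟩
  have := h.mono
  have := h'.mono
  have := h'.epi
  refine of_desc inferInstance inferInstance
    (by rw [Category.assoc, pushout.condition, reassoc_of% h'.zero, zero_comp]) fun T t ht => ?_
  obtain ⟨l, hl⟩ := h'.exists_desc (f ≫ t) (by simpa using ht)
  exact ⟨pushout.desc t l hl.symm, pushout.inl_desc _ _ _⟩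

/-- The preimage `W` in `Y` of a subobject `N` of `Z = Y / X`: it is an extension of `N` by `X`,
and `Y / W = Z / N`. -/
lemma exists_preimage (h : IsShortExact f g) {N M : C} {n : N ⟶ Z} {b : Z ⟶ M}
    (h' : IsShortExact n b) :
    ∃ (W : C) (j : W ⟶ Y) (i : X ⟶ W) (p : W ⟶ N),
      IsShortExact j (g ≫ b) ∧ IsShortExact i p ∧ i ≫ j = f := by
  obtain ⟨W, p, i, q, h₁, h₂, h₃⟩ := h.op.exists_quotient h'.op
  exact ⟨W.unop, p.unop, q.unop, i.unop, h₁.unop, h₂.unop, Quiver.Hom.op_inj h₃⟩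

lemma biprod_map (h : IsShortExact f g) {X' Y' Z' : C} {f' : X' ⟶ Y'} {g' : Y' ⟶ Z'}
    (h' : IsShortExact f' g') : IsShortExact (biprod.map f f') (biprod.map g g') := by
  have := h.mono
  have := h'.mono
  have := h.epi
  have := h'.epi
  refine of_lift inferInstance inferInstance (by ext <;> simp [h.zero, h'.zero]) fun T t ht => ?_
  obtain ⟨l, hl⟩ := h.exists_lift (t ≫ biprod.fst) (by simpa using ht =≫ biprod.fst)
  obtain ⟨l', hl'⟩ := h'.exists_lift (t ≫ biprod.snd) (by simpa using ht =≫ biprod.snd)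
  exact ⟨biprod.lift l l', by ext <;> simp [hl, hl']⟩

lemma biprod_left (h : IsShortExact f g) (W : C) :
    IsShortExact (biprod.map (𝟙 W) f) (biprod.snd ≫ g) := by
  have := h.mono
  have := h.epi
  refine of_lift inferInstance inferInstance (by simp [h.zero]) fun T t ht => ?_
  obtain ⟨l, hl⟩ := h.exists_lift (t ≫ biprod.snd) (by simpa using ht)
  exact ⟨biprod.lift (t ≫ biprod.fst) l, by ext <;> simp [hl]⟩

lemma biprod_right (h : IsShortExact f g) (W : C) :
    IsShortExact (f ≫ biprod.inr) (biprod.map (𝟙 W) g) := by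
  have := h.mono
  have := h.epi
  refine of_desc inferInstance inferInstance (by simp [reassoc_of% h.zero]) fun T t ht => ?_
  obtain ⟨l, hl⟩ := h.exists_desc (biprod.inr ≫ t) (by simpa using ht)
  exact ⟨biprod.desc (biprod.inl ≫ t) l, by ext <;> simp [hl]⟩

end IsShortExact

lemma nonempty_iso_biprod_of_retract {M N : C} (r : Retract M N) :
    ∃ M' : C, Nonempty (N ≅ M ⊞ M') := by
  have h := IsShortExact.of_epi r.r
  exact ⟨_, ⟨(ShortComplex.Splitting.ofExactOfSection _ h.2.exact r.i r.retract
    h.mono).isoBinaryBiproduct ≪≫ biprod.braiding _ _⟩⟩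

end ShortExactSequences

/-! ### Splicing short exact sequences into complexes -/

section Splicing

variable {C : Type u} [Category.{v} C] [Abelian C]

lemma IsShortExact.exact_splice {X Y Z T W : C} {f : X ⟶ Y} {g : Y ⟶ Z} (h : IsShortExact f g)
    (p : T ⟶ X) [Epi p] (j : Z ⟶ W) [Mono j] (w : (p ≫ f) ≫ g ≫ j = 0) :
    (ShortComplex.mk (p ≫ f) (g ≫ j) w).Exact := by
  rw [ShortComplex.exact_iff_exact_up_to_refinements]
  intro A x hx
  obtain ⟨l, hl⟩ := h.exists_lift x (by rw [← cancel_mono j]; simpa using hx)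
  obtain ⟨A', π, hπ, y, hy⟩ := surjective_up_to_refinements_of_epi p l
  exact ⟨A', π, hπ, y, by simp [← hl, reassoc_of% hy]⟩

variable {s : ℤ → C}

/-- Short exact sequences `0 ⟶ s (n + 1) ⟶ P n ⟶ s n ⟶ 0` splice to a complex
`⋯ ⟶ P 1 ⟶ P 0 ⟶ P (-1) ⟶ ⋯`. The maps are returned with the terms of the complex as source and
target, so that no further transport along `K.X n = P n` is needed. -/
lemma exists_spliced_chainComplex {P : ℤ → C} {i : ∀ n, s (n + 1) ⟶ P n} {p : ∀ n, P n ⟶ s n}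
    (h : ∀ n, IsShortExact (i n) (p n)) :
    ∃ (K : ChainComplex C ℤ) (e : ∀ n, K.X n = P n)
      (i' : ∀ n, s (n + 1) ⟶ K.X n) (p' : ∀ n, K.X n ⟶ s n),
      (∀ n, IsShortExact (i' n) (p' n)) ∧ (∀ n, K.d (n + 1) n = p' (n + 1) ≫ i' n) ∧
      (∀ n, i' n = i n ≫ eqToHom (e n).symm) ∧ ∀ n, p' n = eqToHom (e n) ≫ p n := by
  refine ⟨ChainComplex.of P (fun n => p (n + 1) ≫ i n) fun n => ?_, fun n => rfl, i, p, h,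
    fun n => ?_, fun n => ?_, fun n => ?_⟩
  · simp [reassoc_of% (h (n + 1)).zero]
  · exact ChainComplex.of_d P (fun n => p (n + 1) ≫ i n) n
  · exact (Category.comp_id _).symm
  · exact (Category.id_comp _).symm

variable {K : ChainComplex C ℤ} {i : ∀ n, s (n + 1) ⟶ K.X n} {p : ∀ n, K.X n ⟶ s n}

lemma acyclic_of_isShortExact (h : ∀ n, IsShortExact (i n) (p n))
    (hd : ∀ n, K.d (n + 1) n = p (n + 1) ≫ i n) : K.Acyclic := by
  intro m
  obtain ⟨n, rfl⟩ : ∃ n, m = n + 1 := ⟨m - 1, by ring⟩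
  have := (h (n + 1 + 1)).epi
  have := (h n).mono
  have e := (h (n + 1)).exact_splice (p (n + 1 + 1)) (i n)
    (by simp [reassoc_of% (h (n + 1)).zero])
  rw [ShortComplex.exact_iff_exact_up_to_refinements] at e
  rw [K.exactAt_iff_exact_up_to_refinements (n + 1 + 1) (n + 1) n (by simp) (by simp),
    hd, hd]
  exact e

lemma nonempty_iso_kernel_of_isShortExact (h : ∀ n, IsShortExact (i n) (p n))
    (hd : ∀ n, K.d (n + 1) n = p (n + 1) ≫ i n) : Nonempty (s 1 ≅ kernel (K.d 0 (-1))) := by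
  suffices H : ∀ n, Nonempty (s (n + 1 + 1) ≅ kernel (K.d (n + 1) n)) by
    have := H (-1)
    rwa [show (-1 : ℤ) + 1 = 0 by norm_num, zero_add] at this
  intro n
  have hm := (h n).mono
  have h0 := h (n + 1)
  have hz (T : C) (t : T ⟶ K.X (n + 1)) (ht : t ≫ K.d (n + 1) n = 0) : t ≫ p (n + 1) = 0 := by
    rw [hd, ← Category.assoc] at ht
    exact zero_of_comp_mono (i n) ht
  obtain ⟨l, hl⟩ := h0.exists_lift _ (hz _ _ (kernel.condition (K.d (n + 1) n)))
  have hi : i (n + 1) ≫ K.d (n + 1) n = 0 := by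
    rw [hd, ← Category.assoc, h0.zero, zero_comp]
  have := h0.mono
  exact ⟨kernel.lift _ (i (n + 1)) hi, l, by rw [← cancel_mono (i (n + 1))]; simp [hl],
    by rw [← cancel_mono (kernel.ι (K.d (n + 1) n))]; simp [hl]⟩

lemma isShortExact_cycles {K : ChainComplex C ℤ} (hK : K.Acyclic) (n : ℤ) :
    IsShortExact (K.iCycles (n + 1)) (K.toCycles (n + 1) n) := by
  refine IsShortExact.of_lift inferInstance ?_ ?_ fun T t ht => ?_
  · have hn := hK n
    rw [K.exactAt_iff_exact_up_to_refinements (n + 1) n (n - 1) (by simp) (by simp)] at hn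
    rw [epi_iff_surjective_up_to_refinements]
    intro A z
    obtain ⟨A', π, hπ, x, hx⟩ := hn (z ≫ K.iCycles n) (by
      rw [Category.assoc, K.iCycles_d, comp_zero])
    refine ⟨A', π, hπ, x, ?_⟩
    rw [← cancel_mono (K.iCycles n)]
    rw [Category.assoc, Category.assoc, K.toCycles_i, hx]
  · rw [← cancel_mono (K.iCycles n)]
    simp
  · have : t ≫ K.d (n + 1) n = 0 := by
      rw [← K.toCycles_i (n + 1) n, reassoc_of% ht, zero_comp]
    exact ⟨K.liftCycles t n (by simp) this, K.liftCycles_i _ _ _ _⟩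

lemma nonempty_cycles_iso (K : ChainComplex C ℤ) :
    Nonempty (K.cycles 0 ≅ kernel (K.d 0 (-1))) :=
  ⟨(K.cyclesIsKernel 0 (-1) (by simp)).conePointUniqueUpToIso (limit.isLimit _)⟩

end Splicing

/-! ### Biserial classes -/

/-- A class `𝒳` is biserial for the relation `r` if each of its members has an `r`-successor and an
`r`-predecessor in `𝒳`. -/
def IsBiserial {α : Type*} (r : α → α → Prop) (𝒳 : α → Prop) : Prop :=
  ∀ x, 𝒳 x → (∃ y, 𝒳 y ∧ r x y) ∧ ∃ y, 𝒳 y ∧ r y x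

/-- Through each member of a biserial class runs a two-sided sequence of members. -/
lemma IsBiserial.exists_int_sequence {α : Type*} {r : α → α → Prop} {𝒳 : α → Prop}
    (h : IsBiserial r 𝒳) {x : α} (hx : 𝒳 x) (k : ℤ) :
    ∃ s : ℤ → α, s k = x ∧ ∀ n, r (s (n + 1)) (s n) := by
  choose f hf hrf using fun y : {y // 𝒳 y} => (h y.1 y.2).1
  choose g hg hrg using fun y : {y // 𝒳 y} => (h y.1 y.2).2
  let f' : {y // 𝒳 y} → {y // 𝒳 y} := fun y => ⟨f y, hf y⟩
  let g' : {y // 𝒳 y} → {y // 𝒳 y} := fun y => ⟨g y, hg y⟩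
  let t : ℤ → {y // 𝒳 y} := fun n => match n with
    | .ofNat n => g'^[n] ⟨x, hx⟩
    | .negSucc n => f'^[n + 1] ⟨x, hx⟩
  have ht : ∀ n, r (t (n + 1)) (t n) := by
    rintro (n | n)
    · change r (g'^[n + 1] ⟨x, hx⟩).1 (g'^[n] ⟨x, hx⟩).1
      rw [Function.iterate_succ_apply']
      exact hrg _
    · cases n with
      | zero => exact hrf ⟨x, hx⟩
      | succ n =>
        change r (f'^[n + 1] ⟨x, hx⟩).1 (f'^[n + 1 + 1] ⟨x, hx⟩).1
        rw [Function.iterate_succ_apply' f' (n + 1)]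
        exact hrf _
  refine ⟨fun n => t (n - k), by simp [t], fun n => ?_⟩
  have := ht (n - k)
  rwa [show n - k + 1 = n + 1 - k by ring] at this

/-! ### Gorenstein projective objects through biserial classes -/

section Steps

variable {C : Type u} [Category.{v} C] [Abelian C]

/-- `X` and `Y` are consecutive syzygies in a totally acyclic complex of projectives: there is a
short exact sequence `0 ⟶ X ⟶ P ⟶ Y ⟶ 0` with `P` projective that stays exact under `Hom(-, Q)`
for every projective `Q`. -/
def GorensteinProjectiveStep (X Y : C) : Prop :=
  ∃ (P : C) (i : X ⟶ P) (p : P ⟶ Y), IsShortExact i p ∧ Projective P ∧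
    ∀ Q : C, Projective Q → ∀ f : X ⟶ Q, ∃ g : P ⟶ Q, i ≫ g = f

/-- `X` and `Y` are consecutive syzygies in a totally acyclic complex of injectives: there is a
short exact sequence `0 ⟶ X ⟶ I ⟶ Y ⟶ 0` with `I` injective that stays exact under `Hom(J, -)`
for every injective `J`. -/
def GorensteinInjectiveStep (X Y : C) : Prop :=
  ∃ (I : C) (i : X ⟶ I) (p : I ⟶ Y), IsShortExact i p ∧ Injective I ∧
    ∀ J : C, Injective J → ∀ f : J ⟶ Y, ∃ g : J ⟶ I, g ≫ p = f

lemma GorensteinProjectiveStep.of_iso {X Y X' Y' : C} (h : GorensteinProjectiveStep X Y)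
    (e : X ≅ X') (e' : Y ≅ Y') : GorensteinProjectiveStep X' Y' := by
  obtain ⟨P, i, p, hip, hP, H⟩ := h
  refine ⟨P, _, _, (hip.iso_comp e.symm).comp_iso e', hP, fun Q hQ f => ?_⟩
  obtain ⟨g, hg⟩ := H Q hQ (e.hom ≫ f)
  exact ⟨g, by simp [hg]⟩

lemma GorensteinInjectiveStep.of_iso {X Y X' Y' : C} (h : GorensteinInjectiveStep X Y)
    (e : X ≅ X') (e' : Y ≅ Y') : GorensteinInjectiveStep X' Y' := by
  obtain ⟨P, i, p, hip, hP, H⟩ := h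
  refine ⟨P, _, _, (hip.iso_comp e.symm).comp_iso e', hP, fun Q hQ f => ?_⟩
  obtain ⟨g, hg⟩ := H Q hQ (f ≫ e'.inv)
  exact ⟨g, by simp [reassoc_of% hg]⟩

/-- Gorenstein projectivity is coinductive: `M` is Gorenstein projective as soon as it belongs to
a class of objects each of which has a syzygy and a cosyzygy in the class. -/
theorem isGorensteinProjective_iff {M : C} :
    IsGorensteinProjective M ↔ ∃ 𝒳 : C → Prop, IsBiserial GorensteinProjectiveStep 𝒳 ∧ 𝒳 M := by
  constructor
  · rintro ⟨P, hP, ⟨e⟩⟩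
    have step (n : ℤ) : GorensteinProjectiveStep (P.cycles (n + 1)) (P.cycles n) := by
      refine ⟨_, _, _, isShortExact_cycles hP.exact n, hP.projective _, fun Q hQ f => ?_⟩
      have hf := hP.hom_exact Q hQ (n + 1 + 1) (P.toCycles (n + 1 + 1) (n + 1) ≫ f) (by
        rw [← Category.assoc, show P.d (n + 1 + 1 + 1) (n + 1 + 1) ≫
          P.toCycles (n + 1 + 1) (n + 1) = 0 by
            rw [← cancel_mono (P.iCycles (n + 1))]; simp, zero_comp])
      rw [add_sub_cancel_right] at hf
      obtain ⟨g, hg⟩ := hf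
      have := (isShortExact_cycles hP.exact (n + 1)).epi
      exact ⟨g, by rw [← cancel_epi (P.toCycles (n + 1 + 1) (n + 1)), ← hg,
        ← P.toCycles_i (n + 1 + 1) (n + 1), Category.assoc]⟩
    refine ⟨fun X => ∃ n, Nonempty (P.cycles n ≅ X), ?_,
      0, ⟨(nonempty_cycles_iso P).some ≪≫ e.symm⟩⟩
    rintro X ⟨n, ⟨e⟩⟩
    refine ⟨⟨_, ⟨n - 1, ⟨Iso.refl _⟩⟩, ?_⟩, _, ⟨n + 1, ⟨Iso.refl _⟩⟩,
      (step n).of_iso (Iso.refl _) e⟩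
    obtain ⟨m, rfl⟩ : ∃ m, n = m + 1 := ⟨n - 1, by ring⟩
    rw [add_sub_cancel_right]
    exact (step m).of_iso e (Iso.refl _)
  · rintro ⟨𝒳, h𝒳, hM⟩
    obtain ⟨s, rfl, hs⟩ := h𝒳.exists_int_sequence hM 1
    choose P i p hip hP H using hs
    obtain ⟨K, e, i', p', h', hd, hi, hp⟩ := exists_spliced_chainComplex hip
    refine ⟨K, ⟨fun n => e n ▸ hP n, acyclic_of_isShortExact h' hd, fun Q hQ m f hf => ?_⟩,
      nonempty_iso_kernel_of_isShortExact h' hd⟩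
    generalize hk : m - 1 = k
    obtain rfl : m = k + 1 := by rw [← hk]; ring
    have := (h' (k + 1 + 1)).epi
    obtain ⟨l, hl⟩ := (h' (k + 1)).exists_desc f (by
      rw [hd, Category.assoc] at hf
      exact zero_of_epi_comp _ hf)
    obtain ⟨g, hg⟩ := H k Q hQ l
    refine ⟨eqToHom (e k) ≫ g, ?_⟩
    rw [hd, hi, ← hl, ← hg]
    simp

lemma isGorensteinInjective_iff {M : C} :
    IsGorensteinInjective M ↔ ∃ 𝒳 : C → Prop, IsBiserial GorensteinInjectiveStep 𝒳 ∧ 𝒳 M := by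
  constructor
  · rintro ⟨P, hP, ⟨e⟩⟩
    have step (n : ℤ) : GorensteinInjectiveStep (P.cycles (n + 1)) (P.cycles n) := by
      refine ⟨_, _, _, isShortExact_cycles hP.exact n, hP.injective _, fun Q hQ f => ?_⟩
      obtain ⟨g, hg⟩ := hP.hom_exact Q hQ n (f ≫ P.iCycles n) (by simp)
      exact ⟨g, by rw [← cancel_mono (P.iCycles n), Category.assoc, P.toCycles_i, hg]⟩
    refine ⟨fun X => ∃ n, Nonempty (P.cycles n ≅ X), ?_,
      0, ⟨(nonempty_cycles_iso P).some ≪≫ e.symm⟩⟩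
    rintro X ⟨n, ⟨e⟩⟩
    refine ⟨⟨_, ⟨n - 1, ⟨Iso.refl _⟩⟩, ?_⟩, _, ⟨n + 1, ⟨Iso.refl _⟩⟩,
      (step n).of_iso (Iso.refl _) e⟩
    obtain ⟨m, rfl⟩ : ∃ m, n = m + 1 := ⟨n - 1, by ring⟩
    rw [add_sub_cancel_right]
    exact (step m).of_iso e (Iso.refl _)
  · rintro ⟨𝒳, h𝒳, hM⟩
    obtain ⟨s, rfl, hs⟩ := h𝒳.exists_int_sequence hM 1
    choose P i p hip hP H using hs
    obtain ⟨K, e, i', p', h', hd, hi, hp⟩ := exists_spliced_chainComplex hip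
    refine ⟨K, ⟨fun n => e n ▸ hP n, acyclic_of_isShortExact h' hd, fun J hJ m f hf => ?_⟩,
      nonempty_iso_kernel_of_isShortExact h' hd⟩
    generalize hk : m - 1 = k at hf
    obtain rfl : m = k + 1 := by rw [← hk]; ring
    have := (h' k).mono
    obtain ⟨l, hl⟩ := (h' (k + 1)).exists_lift f (by
      rw [hd, ← Category.assoc] at hf
      exact zero_of_comp_mono _ hf)
    obtain ⟨g, hg⟩ := H (k + 1 + 1) J hJ l
    refine ⟨g ≫ eqToHom (e (k + 1 + 1)).symm, ?_⟩
    rw [hd, hp, ← hl, ← hg]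
    simp

lemma gorensteinInjectiveStep_iff_op {X Y : C} :
    GorensteinInjectiveStep X Y ↔ GorensteinProjectiveStep (Opposite.op Y) (Opposite.op X) := by
  constructor
  · rintro ⟨I, i, p, hip, hI, H⟩
    refine ⟨_, _, _, hip.op, inferInstance, fun Q hQ f => ?_⟩
    obtain ⟨g, hg⟩ := H Q.unop inferInstance f.unop
    exact ⟨g.op, Quiver.Hom.unop_inj hg⟩
  · rintro ⟨P, i, p, hip, hP, H⟩
    refine ⟨_, _, _, hip.unop, inferInstance, fun J hJ f => ?_⟩
    obtain ⟨g, hg⟩ := H (Opposite.op J) inferInstance f.op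
    exact ⟨g.unop, Quiver.Hom.op_inj hg⟩

theorem isGorensteinInjective_iff_op {M : C} :
    IsGorensteinInjective M ↔ IsGorensteinProjective (Opposite.op M) := by
  rw [isGorensteinInjective_iff, isGorensteinProjective_iff]
  constructor
  · rintro ⟨𝒳, h𝒳, hM⟩
    refine ⟨fun X => 𝒳 X.unop, fun X hX => ?_, hM⟩
    obtain ⟨⟨Y, hY, hXY⟩, Z, hZ, hZX⟩ := h𝒳 _ hX
    exact ⟨⟨_, hZ, gorensteinInjectiveStep_iff_op.1 hZX⟩, _, hY,
      gorensteinInjectiveStep_iff_op.1 hXY⟩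
  · rintro ⟨𝒳, h𝒳, hM⟩
    refine ⟨fun X => 𝒳 (Opposite.op X), fun X hX => ?_, hM⟩
    obtain ⟨⟨Y, hY, hXY⟩, Z, hZ, hZX⟩ := h𝒳 _ hX
    exact ⟨⟨_, hZ, gorensteinInjectiveStep_iff_op.2 hZX⟩, _, hY,
      gorensteinInjectiveStep_iff_op.2 hXY⟩

end Steps

/-! ### Closure properties of Gorenstein projective objects -/

section Closure

variable {C : Type u} [Category.{v} C] [Abelian C]

/-- `Ext¹(X, Q) = 0` for every projective object `Q`, expressed through extension of morphisms:
for every subobject `Y` with quotient `X`, morphisms from `Y` to `Q` extend. -/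
def IsExtOrthogonalToProjectives (X : C) : Prop :=
  ∀ Q : C, Projective Q → ∀ (Y Z : C) (i : Y ⟶ Z) (p : Z ⟶ X), IsShortExact i p →
    ∀ f : Y ⟶ Q, ∃ g : Z ⟶ Q, i ≫ g = f

namespace IsExtOrthogonalToProjectives

variable {X Y Z : C}

/-- It suffices to extend morphisms along one projective presentation. -/
lemma of_projective {P : C} {i : Y ⟶ P} {p : P ⟶ X} (h : IsShortExact i p) (hP : Projective P)
    (H : ∀ Q : C, Projective Q → ∀ f : Y ⟶ Q, ∃ g : P ⟶ Q, i ≫ g = f) :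
    IsExtOrthogonalToProjectives X := by
  intro Q hQ Y' Z' i' p' h' f
  have := h'.epi
  have := h.epi
  have := h'.mono
  -- A lift `l` of `p` along `p'` restricts to `k : Y ⟶ Y'`; `Z'` is the pushout of `i` and `k`,
  -- so that a morphism on `Y'` extends to `Z'` once its restriction to `Y` extends to `P`.
  obtain ⟨l, hl⟩ : ∃ l : P ⟶ Z', l ≫ p' = p := ⟨_, Projective.factorThru_comp p p'⟩
  obtain ⟨k, hk⟩ := h'.exists_lift (i ≫ l) (by rw [Category.assoc, hl, h.zero])
  obtain ⟨e, he⟩ := H Q hQ (k ≫ f)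
  have hs : IsShortExact (biprod.lift k (-i)) (biprod.desc i' l) := by
    have := h.mono
    refine IsShortExact.of_lift ?_ ?_ ?_ ?_
    · have : Mono (biprod.lift k (-i) ≫ biprod.snd) := by
        rw [biprod.lift_snd]; infer_instance
      exact mono_of_mono _ biprod.snd
    · refine Preadditive.epi_of_cancel_zero _ fun t ht => ?_
      have h₁ : i' ≫ t = 0 := by simpa using biprod.inl ≫= ht
      have h₂ : l ≫ t = 0 := by simpa using biprod.inr ≫= ht
      obtain ⟨t', rfl⟩ := h'.exists_desc t h₁
      rw [← Category.assoc, hl] at h₂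
      rw [zero_of_epi_comp _ h₂, comp_zero]
    · simp [hk]
    · intro T t ht
      have ht' : t ≫ biprod.fst ≫ i' + t ≫ biprod.snd ≫ l = 0 := by
        rw [← ht, biprod.desc_eq]; simp
      obtain ⟨m, hm⟩ := h.exists_lift (-(t ≫ biprod.snd)) (by
        have := ht' =≫ p'
        simpa [h'.zero, hl] using this)
      refine ⟨m, biprod.hom_ext _ _ ?_ ?_⟩
      · rw [← cancel_mono i']
        simp only [Category.assoc, biprod.lift_fst, hk]
        rw [reassoc_of% hm, Preadditive.neg_comp, Category.assoc, eq_comm,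
          eq_neg_iff_add_eq_zero, ht']
      · simp [hm]
  obtain ⟨g, hg⟩ := hs.exists_desc (biprod.desc f e) (by simp [he])
  exact ⟨g, by simpa using biprod.inl ≫= hg⟩

lemma projective (hX : Projective X) : IsExtOrthogonalToProjectives X := by
  intro Q _ Y Z i p h f
  have : Projective (ShortComplex.mk i p h.1).X₃ := hX
  exact ⟨h.2.splittingOfProjective.r ≫ f, by
    rw [← Category.assoc, h.2.splittingOfProjective.f_r, Category.id_comp]⟩

lemma of_extension {f : X ⟶ Y} {g : Y ⟶ Z} (h : IsShortExact f g)
    (hX : IsExtOrthogonalToProjectives X) (hZ : IsExtOrthogonalToProjectives Z) :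
    IsExtOrthogonalToProjectives Y := by
  intro Q hQ Y' Z' i p hip t
  obtain ⟨W, j, k, q, hj, hk, rfl⟩ := hip.exists_preimage h
  obtain ⟨g₁, rfl⟩ := hX Q hQ _ _ _ _ hk t
  obtain ⟨g₂, rfl⟩ := hZ Q hQ _ _ _ _ hj g₁
  exact ⟨g₂, Category.assoc _ _ _⟩

lemma of_retract (r : Retract X Y) (hY : IsExtOrthogonalToProjectives Y) :
    IsExtOrthogonalToProjectives X := by
  intro Q hQ Y' Z' i p h f
  obtain ⟨g, hg⟩ := hY Q hQ _ _ _ _ (h.pullback r.r) f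
  refine ⟨pullback.lift (𝟙 Z') (p ≫ r.i) (by simp) ≫ g, ?_⟩
  rw [← hg, ← Category.assoc]
  congr 1
  refine pullback.hom_ext ?_ ?_
  · rw [Category.assoc, pullback.lift_fst, pullback.lift_fst, Category.comp_id]
  · rw [Category.assoc, pullback.lift_snd, pullback.lift_snd, ← Category.assoc, h.zero, zero_comp]

end IsExtOrthogonalToProjectives

lemma GorensteinProjectiveStep.isExtOrthogonalToProjectives {X Y : C}
    (h : GorensteinProjectiveStep X Y) : IsExtOrthogonalToProjectives Y := by
  obtain ⟨P, i, p, hip, hP, H⟩ := h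
  exact .of_projective hip hP H

namespace IsGorensteinProjective

variable {M N X Y Z : C}

lemma isExtOrthogonalToProjectives (hM : IsGorensteinProjective M) :
    IsExtOrthogonalToProjectives M := by
  obtain ⟨𝒳, h𝒳, hM⟩ := isGorensteinProjective_iff.1 hM
  obtain ⟨-, Y, -, hY⟩ := h𝒳 M hM
  exact hY.isExtOrthogonalToProjectives

lemma exists_cosyzygy (hM : IsGorensteinProjective M) :
    ∃ (P G : C) (i : M ⟶ P) (p : P ⟶ G),
      IsShortExact i p ∧ Projective P ∧ IsGorensteinProjective G := by
  obtain ⟨𝒳, h𝒳, hM⟩ := isGorensteinProjective_iff.1 hM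
  obtain ⟨⟨Y, hY, P, i, p, h, hP, -⟩, -⟩ := h𝒳 M hM
  exact ⟨P, Y, i, p, h, hP, isGorensteinProjective_iff.2 ⟨𝒳, h𝒳, hY⟩⟩

lemma exists_syzygy (hM : IsGorensteinProjective M) :
    ∃ (P G : C) (i : G ⟶ P) (p : P ⟶ M),
      IsShortExact i p ∧ Projective P ∧ IsGorensteinProjective G := by
  obtain ⟨𝒳, h𝒳, hM⟩ := isGorensteinProjective_iff.1 hM
  obtain ⟨-, ⟨Y, hY, P, i, p, h, hP, -⟩⟩ := h𝒳 M hM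
  exact ⟨P, Y, i, p, h, hP, isGorensteinProjective_iff.2 ⟨𝒳, h𝒳, hY⟩⟩

/-- The coinduction principle for Gorenstein projective objects. -/
lemma of_class (𝒳 : C → Prop) (h_ext : ∀ X, 𝒳 X → IsExtOrthogonalToProjectives X)
    (h_cosyzygy : ∀ X, 𝒳 X → ∃ (P Y : C) (i : X ⟶ P) (p : P ⟶ Y),
      IsShortExact i p ∧ Projective P ∧ 𝒳 Y)
    (h_syzygy : ∀ X, 𝒳 X → ∃ (P Y : C) (i : Y ⟶ P) (p : P ⟶ X),
      IsShortExact i p ∧ Projective P ∧ 𝒳 Y) (hM : 𝒳 M) : IsGorensteinProjective M := by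
  refine isGorensteinProjective_iff.2 ⟨𝒳, fun X hX => ⟨?_, ?_⟩, hM⟩
  · obtain ⟨P, Y, i, p, h, hP, hY⟩ := h_cosyzygy X hX
    exact ⟨Y, hY, P, i, p, h, hP, fun Q hQ f => h_ext Y hY Q hQ _ _ _ _ h f⟩
  · obtain ⟨P, Y, i, p, h, hP, hY⟩ := h_syzygy X hX
    exact ⟨Y, hY, P, i, p, h, hP, fun Q hQ f => h_ext X hX Q hQ _ _ _ _ h f⟩

lemma of_iso (hM : IsGorensteinProjective M) (e : M ≅ N) : IsGorensteinProjective N := by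
  obtain ⟨P, hP, ⟨e'⟩⟩ := hM
  exact ⟨P, hP, ⟨e.symm ≪≫ e'⟩⟩

lemma of_projective (hM : Projective M) : IsGorensteinProjective M := by
  refine of_class (fun X => Projective X) (fun X hX => .projective hX) (fun X hX => ?_)
    (fun X hX => ?_) hM
  · exact ⟨X, _, 𝟙 X, _, .of_mono (𝟙 X), hX,
      (isZero_cokernel_of_epi (𝟙 X)).projective⟩
  · exact ⟨X, _, _, 𝟙 X, .of_epi (𝟙 X), hX,
      (isZero_kernel_of_mono (𝟙 X)).projective⟩

/-- Gorenstein projective objects are closed under extensions. -/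
theorem of_extension {f : X ⟶ Y} {g : Y ⟶ Z} (h : IsShortExact f g)
    (hX : IsGorensteinProjective X) (hZ : IsGorensteinProjective Z) :
    IsGorensteinProjective Y := by
  refine of_class (fun E => ∃ (X Z : C) (f : X ⟶ E) (g : E ⟶ Z), IsShortExact f g ∧
    IsGorensteinProjective X ∧ IsGorensteinProjective Z) ?_ ?_ ?_ ⟨X, Z, f, g, h, hX, hZ⟩
  · rintro E ⟨X, Z, f, g, h, hX, hZ⟩
    exact .of_extension h hX.isExtOrthogonalToProjectives hZ.isExtOrthogonalToProjectives
  · rintro E ⟨X, Z, f, g, h, hX, hZ⟩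
    obtain ⟨P, X', i, p, hP, hPp, hX'⟩ := hX.exists_cosyzygy
    obtain ⟨Q, Z', j, q, hQ, hQp, hZ'⟩ := hZ.exists_cosyzygy
    -- The pushout of `E` along `X ⟶ P` splits as `P ⊞ Z`, which embeds into `P ⊞ Q`.
    obtain ⟨W, a, b, c, d, hab, hcd⟩ := h.exists_pushout hP
    obtain ⟨r, hr⟩ := hZ.isExtOrthogonalToProjectives P hPp _ _ _ _ hab (𝟙 P)
    have e : W ≅ P ⊞ Z :=
      (ShortComplex.Splitting.ofExactOfRetraction _ hab.2.exact r hr hab.epi).isoBinaryBiproduct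
    obtain ⟨V, p', i', q', h₁, h₂, -⟩ := ((hQ.biprod_left P).iso_comp e).exists_quotient hcd
    exact ⟨P ⊞ Q, V, _, _, h₁, inferInstance, _, _, _, _, h₂, hX', hZ'⟩
  · rintro E ⟨X, Z, f, g, h, hX, hZ⟩
    obtain ⟨P, X', i, p, hP, hPp, hX'⟩ := hX.exists_syzygy
    obtain ⟨Q, Z', j, q, hQ, hQp, hZ'⟩ := hZ.exists_syzygy
    -- The pullback of `E` along `Q ⟶ Z` splits as `X ⊞ Q`, onto which `Q ⊞ P` maps.
    obtain ⟨W, a, b, c, d, hab, hcd⟩ := h.exists_pullback hQ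
    obtain ⟨e⟩ := hab.nonempty_iso_biprod_of_projective hQp
    obtain ⟨V, p', i', q', h₁, h₂, -⟩ := ((hP.biprod_right Q).comp_iso
      (biprod.braiding _ _ ≪≫ e.symm)).exists_preimage hcd
    exact ⟨Q ⊞ P, V, _, _, h₁, inferInstance, _, _, _, _, h₂, hX', hZ'⟩

/-- Gorenstein projective objects are closed under direct summands. If `M ⊞ N` embeds into a
projective `P` with Gorenstein projective cokernel `G`, then `M ⊞ (P / M)` is an extension of `G` by
`M ⊞ N`, so that `P / M` is again a summand of a Gorenstein projective object. -/
theorem of_biprod (h : IsGorensteinProjective (M ⊞ N)) : IsGorensteinProjective M := by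
  refine of_class (fun M => ∃ N, IsGorensteinProjective (M ⊞ N)) ?_ ?_ ?_ ⟨N, h⟩
  · rintro M ⟨N, h⟩
    exact h.isExtOrthogonalToProjectives.of_retract ⟨biprod.inl, biprod.fst, biprod.inl_fst⟩
  · rintro M ⟨N, h⟩
    obtain ⟨P, G, i, p, hip, hP, hG⟩ := h.exists_cosyzygy
    obtain ⟨W, p', i', q, h₁, h₂, -⟩ := hip.exists_quotient (.biprod_inl_snd M N)
    exact ⟨P, W, _, _, h₁, hP, M,
      (of_extension (h₂.biprod_left M) h hG).of_iso (biprod.braiding _ _)⟩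
  · rintro M ⟨N, h⟩
    obtain ⟨P, G, i, p, hip, hP, hG⟩ := h.exists_syzygy
    obtain ⟨W, p', i', q, h₁, h₂, -⟩ := hip.exists_preimage (.biprod_inr_fst M N)
    exact ⟨P, W, _, _, h₁, hP, M,
      (of_extension (h₂.biprod_right M) hG h).of_iso (biprod.braiding _ _)⟩

/-- Every syzygy of a Gorenstein projective object is Gorenstein projective: by comparison with a
syzygy `G` that is known to be so, it is a summand of an extension of a projective by `G`. -/
lemma of_syzygy {f : X ⟶ Y} {g : Y ⟶ Z} (h : IsShortExact f g)
    (hY : Projective Y) (hZ : IsGorensteinProjective Z) : IsGorensteinProjective X := by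
  obtain ⟨P, G, i, p, hip, hP, hG⟩ := hZ.exists_syzygy
  obtain ⟨W, a, b, c, d, hab, hcd⟩ := h.exists_pullback hip
  obtain ⟨e⟩ := hab.nonempty_iso_biprod_of_projective hP
  exact ((of_extension hcd hG (of_projective hY)).of_iso e).of_biprod

/-- Gorenstein projective objects are closed under kernels of epimorphisms: if `Y` embeds into a
projective `P` with Gorenstein projective cokernel `G`, then `P / X` is an extension of `G` by `Z`,
and `X` is a syzygy of it. -/
theorem of_shortExact {f : X ⟶ Y} {g : Y ⟶ Z} (h : IsShortExact f g)
    (hY : IsGorensteinProjective Y) (hZ : IsGorensteinProjective Z) :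
    IsGorensteinProjective X := by
  obtain ⟨P, G, i, p, hip, hP, hG⟩ := hY.exists_cosyzygy
  obtain ⟨W, p', i', q, h₁, h₂, -⟩ := hip.exists_quotient h
  exact of_syzygy h₁ hP (of_extension h₂ hZ hG)

end IsGorensteinProjective

/-! ### Gorenstein projective dimension -/

/-- `M` has Gorenstein projective dimension at most `n`. The resolution is encoded by recursion on
its length, through the kernel of its first map. -/
def GorensteinProjectiveDimLE : ℕ → C → Prop
  | 0, M => IsGorensteinProjective M
  | n + 1, M => ∃ (K G : C) (i : K ⟶ G) (p : G ⟶ M), IsShortExact i p ∧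
      IsGorensteinProjective G ∧ GorensteinProjectiveDimLE n K

namespace GorensteinProjectiveDimLE

variable {n : ℕ} {M N X Y Z : C}

lemma of_iso (h : GorensteinProjectiveDimLE n M) (e : M ≅ N) : GorensteinProjectiveDimLE n N := by
  cases n with
  | zero => exact IsGorensteinProjective.of_iso h e
  | succ n =>
    obtain ⟨K, G, i, p, hip, hG, hK⟩ := h
    exact ⟨K, G, i, _, hip.comp_iso e, hG, hK⟩

lemma biprod_projective (h : GorensteinProjectiveDimLE n M) (hN : Projective N) :
    GorensteinProjectiveDimLE n (M ⊞ N) := by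
  cases n with
  | zero => exact .of_extension (.biprod_inl_snd M N) h (.of_projective hN)
  | succ n =>
    obtain ⟨K, G, i, p, hip, hG, hK⟩ := h
    exact ⟨K, N ⊞ G, _, _, (hip.biprod_right N).comp_iso (biprod.braiding _ _),
      .of_extension (.biprod_inl_snd N G) (.of_projective hN) hG, hK⟩

/-- Passing to the kernel of an epimorphism onto a Gorenstein projective object does not increase
the Gorenstein projective dimension. -/
lemma of_shortExact {f : X ⟶ Y} {g : Y ⟶ Z} (h : IsShortExact f g)
    (hY : GorensteinProjectiveDimLE n Y) (hZ : IsGorensteinProjective Z) :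
    GorensteinProjectiveDimLE n X := by
  cases n with
  | zero => exact IsGorensteinProjective.of_shortExact h hY hZ
  | succ n =>
    obtain ⟨K, G, i, p, hip, hG, hK⟩ := hY
    obtain ⟨W, j, k, q, hj, hk, -⟩ := hip.exists_preimage h
    exact ⟨K, W, k, q, hk, .of_shortExact hj hG hZ, hK⟩

/-- If `Z` has Gorenstein projective dimension at most `n + 1`, then the kernel of any projective
presentation of `Z`, not only the kernel in some given resolution, has dimension at most `n`. -/
lemma of_syzygy {f : X ⟶ Y} {g : Y ⟶ Z} (h : IsShortExact f g) (hY : Projective Y)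
    (hZ : GorensteinProjectiveDimLE (n + 1) Z) : GorensteinProjectiveDimLE n X := by
  obtain ⟨K, G, i, p, hip, hG, hK⟩ := hZ
  obtain ⟨W, a, b, c, d, hab, hcd⟩ := h.exists_pullback hip
  obtain ⟨e⟩ := hcd.nonempty_iso_biprod_of_projective hY
  exact of_shortExact hab ((hK.biprod_projective hY).of_iso e.symm) hG

/-- The Gorenstein projective dimension does not increase on passing to a direct summand. -/
theorem of_biprod [EnoughProjectives C] (h : GorensteinProjectiveDimLE n (M ⊞ N)) :
    GorensteinProjectiveDimLE n M := by
  induction n generalizing M N with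
  | zero => exact IsGorensteinProjective.of_biprod h
  | succ n ih =>
    have hM := IsShortExact.of_epi (Projective.π M)
    have hN := IsShortExact.of_epi (Projective.π N)
    exact ⟨_, _, _, _, hM, .of_projective inferInstance,
      ih (of_syzygy (hM.biprod_map hN) inferInstance h)⟩

theorem of_retract [EnoughProjectives C] (h : GorensteinProjectiveDimLE n N) (r : Retract M N) :
    GorensteinProjectiveDimLE n M := by
  obtain ⟨M', ⟨e⟩⟩ := nonempty_iso_biprod_of_retract r
  exact (h.of_iso e).of_biprod

end GorensteinProjectiveDimLE

end Closure

section Resolutions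

variable {C : Type u} [Category.{v} C] [Abelian C]

theorem hasGorensteinProjectiveResolution_iff {M : C} {n : ℕ} :
    HasGorensteinProjectiveResolution M n ↔ GorensteinProjectiveDimLE n M := by
  constructor
  · induction n generalizing M with
    | zero =>
      rintro ⟨G, ε, hε, hG, h0, -, hex, hepi⟩
      have : Mono ε := hex.mono_g ((h0 1 one_pos).eq_of_src _ _)
      have : IsIso ε := isIso_of_mono_of_epi ε
      exact (hG 0 le_rfl).of_iso (asIso ε)
    | succ n ih =>
      rintro ⟨G, ε, hε, hG, h0, hacyc, hex, hepi⟩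
      refine ⟨_, _, _, _, .of_epi ε, hG 0 (Nat.zero_le _), ih ?_⟩
      have hlift : G.d 2 1 ≫ kernel.lift ε (G.d 1 0) hε = 0 := by
        rw [← cancel_mono (kernel.ι ε)]; simp
      have hcancel {A : C} (x : A ⟶ G.X 1) (hx : x ≫ kernel.lift ε (G.d 1 0) hε = 0) :
          x ≫ G.d 1 0 = 0 := by
        rw [← kernel.lift_ι ε (G.d 1 0) hε, reassoc_of% hx, zero_comp]
      have hlift_epi : Epi (kernel.lift ε (G.d 1 0) hε) := by
        rw [ShortComplex.exact_iff_exact_up_to_refinements] at hex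
        rw [epi_iff_surjective_up_to_refinements]
        intro A x
        obtain ⟨A', π, hπ, y, hy⟩ := hex (x ≫ kernel.ι ε) (by simp)
        exact ⟨A', π, hπ, y, by rw [← cancel_mono (kernel.ι ε)]; simpa using hy⟩
      refine ⟨ChainComplex.truncate.obj G, kernel.lift ε (G.d 1 0) hε, hlift,
        fun i hi => hG (i + 1) (by lia), fun i hi => h0 (i + 1) (by lia), fun i hi => ?_, ?_,
        hlift_epi⟩
      · obtain ⟨i, rfl⟩ := Nat.exists_eq_succ_of_ne_zero hi.ne'
        rw [HomologicalComplex.exactAt_iff' _ (i + 1 + 1) (i + 1) i (by simp) (by simp)]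
        have := hacyc (i + 1 + 1) (by lia)
        rwa [G.exactAt_iff' (i + 1 + 1 + 1) (i + 1 + 1) (i + 1) (by simp) (by simp)] at this
      · have := hacyc 1 one_pos
        rw [G.exactAt_iff' 2 1 0 (by simp) (by simp),
          ShortComplex.exact_iff_exact_up_to_refinements] at this
        rw [ShortComplex.exact_iff_exact_up_to_refinements]
        intro A x hx
        exact this x (hcancel x hx)
  · induction n generalizing M with
    | zero =>
      intro h
      have hz (i : ℕ) (hi : i ≠ 0) : IsZero (((ChainComplex.single₀ C).obj M).X i) :=
        HomologicalComplex.isZero_single_obj_X _ _ _ _ hi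
      refine ⟨(ChainComplex.single₀ C).obj M, 𝟙 M, (hz 1 one_ne_zero).eq_of_src _ _,
        fun i hi => ?_, fun i hi => hz i hi.ne', fun i hi => ?_, ?_, ?_⟩
      · obtain rfl : i = 0 := by lia
        exact h
      · exact HomologicalComplex.exactAt_single_obj _ _ _ _ hi.ne'
      · rw [ShortComplex.exact_iff_mono _ ((hz 1 one_ne_zero).eq_of_src _ _)]
        exact inferInstanceAs (Mono (𝟙 M))
      · exact inferInstanceAs (Epi (𝟙 M))
    | succ n ih =>
      rintro ⟨K, G₀, i, p, hip, hG₀, hK⟩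
      obtain ⟨G, ε, hε, hG, h0, hacyc, hex, hepi⟩ := ih hK
      have hi := hip.mono
      have hp := hip.epi
      have hz : (ε ≫ i) ≫ p = 0 := by rw [Category.assoc, hip.zero, comp_zero]
      refine ⟨G.augment (ε ≫ i) (by simp [reassoc_of% hε]), p, hz, ?_, ?_, ?_, ?_, hp⟩
      · rintro (_ | j) hj
        · exact hG₀
        · exact hG j (by lia)
      · rintro (_ | j) hj
        · lia
        · exact h0 j (by lia)
      · rintro (_ | _ | j) hj
        · lia
        · rw [HomologicalComplex.exactAt_iff' _ 2 1 0 (by simp) (by simp)]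
          rw [ShortComplex.exact_iff_exact_up_to_refinements] at hex ⊢
          intro A x hx
          refine hex x ?_
          rw [← cancel_mono i, zero_comp]
          exact (Category.assoc _ _ _).trans hx
        · rw [HomologicalComplex.exactAt_iff' _ (j + 1 + 1 + 1) (j + 1 + 1) (j + 1)
            (by simp) (by simp)]
          have := hacyc (j + 1) (by lia)
          rwa [G.exactAt_iff' (j + 1 + 1) (j + 1) j (by simp) (by simp)] at this
      · have e := hip.exact_splice ε (𝟙 _) (by simp [hip.zero])
        rw [ShortComplex.exact_iff_exact_up_to_refinements] at e ⊢
        intro A x hx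
        exact e x (by simpa using hx)

theorem hasGorensteinInjectiveResolution_iff_op {M : C} {n : ℕ} :
    HasGorensteinInjectiveResolution M n ↔
      HasGorensteinProjectiveResolution (Opposite.op M) n := by
  constructor
  · rintro ⟨G, η, hη, hG, h0, hacyc, hex, hmono⟩
    exact ⟨G.op, η.op, congrArg Quiver.Hom.op hη,
      fun i hi => isGorensteinInjective_iff_op.1 (hG i hi),
      fun i hi => (h0 i hi).op, fun i hi => (hacyc i hi).op, hex.op, op_epi_of_mono η⟩
  · rintro ⟨G, ε, hε, hG, h0, hacyc, hex, hepi⟩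
    exact ⟨G.unop, ε.unop, congrArg Quiver.Hom.unop hε,
      fun i hi => isGorensteinInjective_iff_op.2 (hG i hi),
      fun i hi => (h0 i hi).unop, fun i hi => (hacyc i hi).unop, hex.unop, unop_mono_of_epi ε⟩

lemma gorensteinProjectiveDim_le_of_dimLE {D : Type*} [Category* D] [Abelian D] {M : C} {N : D}
    (h : ∀ n, GorensteinProjectiveDimLE n M → GorensteinProjectiveDimLE n N) :
    gorensteinProjectiveDim N ≤ gorensteinProjectiveDim M :=
  iInf_mono fun n => iInf_mono' fun hM =>
    ⟨hasGorensteinProjectiveResolution_iff.2 (h n (hasGorensteinProjectiveResolution_iff.1 hM)),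
      le_rfl⟩

theorem gorensteinInjectiveDim_eq_op (M : C) :
    gorensteinInjectiveDim M = gorensteinProjectiveDim (Opposite.op M) := by
  simp only [gorensteinInjectiveDim, gorensteinProjectiveDim,
    hasGorensteinInjectiveResolution_iff_op]

end Resolutions

/-! ### Frobenius pairs of functors -/

section FrobeniusPair

variable {C D : Type*} [Category* C] [Category* D] [Abelian C] [Abelian D]
  {F : C ⥤ D} {U : D ⥤ C}

/-- An exact functor `F` preserves Gorenstein projective objects if both `F` and its right adjoint
preserve projective objects. -/
theorem IsGorensteinProjective.map (adj : F ⊣ U) [PreservesFiniteLimits F]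
    (hF : ∀ P, Projective P → Projective (F.obj P))
    (hU : ∀ Q, Projective Q → Projective (U.obj Q)) {M : C} (hM : IsGorensteinProjective M) :
    IsGorensteinProjective (F.obj M) := by
  have := adj.isLeftAdjoint
  have step {X Y : C} (h : GorensteinProjectiveStep X Y) :
      GorensteinProjectiveStep (F.obj X) (F.obj Y) := by
    obtain ⟨P, i, p, hip, hP, H⟩ := h
    refine ⟨_, _, _, hip.map F, hF P hP, fun Q hQ f => ?_⟩
    obtain ⟨g, hg⟩ := H (U.obj Q) (hU Q hQ) (adj.homEquiv _ _ f)
    exact ⟨(adj.homEquiv _ _).symm g, by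
      rw [← adj.homEquiv_naturality_left_symm, hg, Equiv.symm_apply_apply]⟩
  obtain ⟨𝒳, h𝒳, hM⟩ := isGorensteinProjective_iff.1 hM
  refine isGorensteinProjective_iff.2 ⟨fun Y => ∃ X, 𝒳 X ∧ F.obj X = Y, ?_, M, hM, rfl⟩
  rintro _ ⟨X, hX, rfl⟩
  obtain ⟨⟨Y, hY, hXY⟩, Z, hZ, hZX⟩ := h𝒳 X hX
  exact ⟨⟨_, ⟨Y, hY, rfl⟩, step hXY⟩, _, ⟨Z, hZ, rfl⟩, step hZX⟩

/-- The left adjoint in a Frobenius pair does not increase Gorenstein projective dimensions. -/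
theorem GorensteinProjectiveDimLE.map (adj : F ⊣ U) (adj' : U ⊣ F) {n : ℕ} {M : C}
    (hM : GorensteinProjectiveDimLE n M) : GorensteinProjectiveDimLE n (F.obj M) := by
  have := adj.isLeftAdjoint
  have := adj.isRightAdjoint
  have := adj'.isLeftAdjoint
  have := adj'.isRightAdjoint
  have : PreservesLimits F := adj'.rightAdjoint_preservesLimits
  have H {M : C} (hM : IsGorensteinProjective M) : IsGorensteinProjective (F.obj M) :=
    hM.map adj adj.map_projective adj'.map_projective
  induction n generalizing M with
  | zero => exact H hM
  | succ n ih =>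
    obtain ⟨K, G, i, p, hip, hG, hK⟩ := hM
    exact ⟨_, _, _, _, hip.map F, H hG, ih hK⟩

/-- If `F` is both left and right adjoint to `U`, then `U M` is a direct summand of `U F U M` by
the triangle identity, so that all of `U M`, `F U M`, `U F U M` have the same Gorenstein
projective dimension. -/
theorem gorensteinProjectiveDim_eq_of_adjunctions [EnoughProjectives C] (adj : F ⊣ U)
    (adj' : U ⊣ F) (M : D) :
    gorensteinProjectiveDim (U.obj M) = gorensteinProjectiveDim (F.obj (U.obj M)) ∧
      gorensteinProjectiveDim (F.obj (U.obj M)) =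
        gorensteinProjectiveDim (U.obj (F.obj (U.obj M))) := by
  have h₁ : gorensteinProjectiveDim (F.obj (U.obj M)) ≤ gorensteinProjectiveDim (U.obj M) :=
    gorensteinProjectiveDim_le_of_dimLE fun n h => h.map adj adj'
  have h₂ : gorensteinProjectiveDim (U.obj (F.obj (U.obj M))) ≤
      gorensteinProjectiveDim (F.obj (U.obj M)) :=
    gorensteinProjectiveDim_le_of_dimLE fun n h => h.map adj' adj
  have h₃ : gorensteinProjectiveDim (U.obj M) ≤
      gorensteinProjectiveDim (U.obj (F.obj (U.obj M))) :=
    gorensteinProjectiveDim_le_of_dimLE fun n h => h.of_retract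
      ⟨adj.unit.app (U.obj M), U.map (adj.counit.app M), adj.right_triangle_components M⟩
  exact ⟨le_antisymm (h₃.trans h₂) h₁, le_antisymm (h₁.trans h₃) h₂⟩

/-- The injective counterpart: in the opposite categories `F` and `U` are again adjoint on both
sides, with the two adjunctions exchanged. -/
theorem gorensteinInjectiveDim_eq_of_adjunctions [EnoughInjectives C] (adj : F ⊣ U)
    (adj' : U ⊣ F) (M : D) :
    gorensteinInjectiveDim (U.obj M) = gorensteinInjectiveDim (F.obj (U.obj M)) ∧
      gorensteinInjectiveDim (F.obj (U.obj M)) =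
        gorensteinInjectiveDim (U.obj (F.obj (U.obj M))) := by
  simp only [gorensteinInjectiveDim_eq_op]
  exact gorensteinProjectiveDim_eq_of_adjunctions adj'.op adj.op (Opposite.op M)

end FrobeniusPair

/-! ### Induction and restriction along a Frobenius extension -/

section Induction

variable {R : Type u} {A : Type v} [Ring R] [Ring A] (ι : R →+* A)

/-- The class of `a ⊗ m` in `A ⊗_R M`. -/
noncomputable def inducedModule.tmul {M : ModuleCat.{w} R} (a : A) (m : M) : inducedModule ι M :=
  Submodule.Quotient.mk (p := tensorRelations ι M) (a ⊗ₜ[ℤ] m)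

namespace inducedModule

variable {M : ModuleCat.{w} R}

lemma add_tmul (a b : A) (m : M) : tmul ι (a + b) m = tmul ι a m + tmul ι b m := by
  simp only [tmul, TensorProduct.add_tmul]
  rfl

lemma tmul_add (a : A) (m n : M) : tmul ι a (m + n) = tmul ι a m + tmul ι a n := by
  simp only [tmul, TensorProduct.tmul_add]
  rfl

lemma sum_tmul {κ : Type*} (s : Finset κ) (a : κ → A) (m : M) :
    tmul ι (∑ i ∈ s, a i) m = ∑ i ∈ s, tmul ι (a i) m :=
  map_sum (AddMonoidHom.mk' (fun a => tmul ι a m) fun a b => add_tmul ι a b m) a s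

lemma mul_tmul (a : A) (r : R) (m : M) : tmul ι (a * ι r) m = tmul ι a (r • m) :=
  (Submodule.Quotient.eq _).2 (Submodule.subset_span ⟨a, r, m, rfl⟩)

lemma smul_tmul (b a : A) (m : M) : b • tmul ι a m = tmul ι (b * a) m := rfl

@[elab_as_elim]
lemma induction_on {p : inducedModule ι M → Prop} (z : inducedModule ι M)
    (h_tmul : ∀ a m, p (tmul ι a m)) (h_add : ∀ y z, p y → p z → p (y + z)) : p z := by
  obtain ⟨z, rfl⟩ := Submodule.Quotient.mk_surjective _ z
  induction z with
  | zero =>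
    have : tmul ι 0 (0 : M) = Submodule.Quotient.mk (p := tensorRelations ι M) 0 := by
      rw [tmul, TensorProduct.zero_tmul]
    exact this ▸ h_tmul 0 0
  | tmul a m => exact h_tmul a m
  | add y z hy hz => exact h_add _ _ hy hz

/-- The additive map out of `A ⊗_R M` given by an `R`-balanced biadditive map on `A × M`. -/
noncomputable def lift {N : Type*} [AddCommGroup N] (φ : A →+ M →+ N)
    (h : ∀ a r m, φ (a * ι r) m = φ a (r • m)) : inducedModule ι M →+ N :=
  let g : A ⊗[ℤ] M →+ N := TensorProduct.liftAddHom φ fun r a m => by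
    simp only [map_zsmul, AddMonoidHom.smul_apply]
  let g' : (A ⊗[ℤ] M) ⧸ (tensorRelations ι M).restrictScalars ℤ →ₗ[ℤ] N :=
    Submodule.liftQ _ g.toIntLinearMap fun z (hz : z ∈ tensorRelations ι M) => by
      change g z = 0
      -- The generating relations are stable under the action of `A`.
      have H : ∀ b : A, g (b • z) = 0 := by
        induction hz using Submodule.span_induction with
        | mem z hz =>
          obtain ⟨a, r, m, rfl⟩ := hz
          intro b
          rw [smul_sub, TensorProduct.smul_tmul', TensorProduct.smul_tmul', map_sub, sub_eq_zero]
          simp only [g, TensorProduct.liftAddHom_tmul, smul_eq_mul]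
          rw [← mul_assoc, h]
        | zero => simp
        | add y z _ _ hy hz => intro b; rw [smul_add, map_add, hy, hz, add_zero]
        | smul c z _ hz => intro b; rw [smul_smul]; exact hz _
      simpa using H 1
  (g'.comp
    (Submodule.Quotient.restrictScalarsEquiv ℤ (tensorRelations ι M)).symm.toLinearMap).toAddMonoidHom

lemma lift_tmul {N : Type*} [AddCommGroup N] (φ : A →+ M →+ N)
    (h : ∀ a r m, φ (a * ι r) m = φ a (r • m)) (a : A) (m : M) :
    lift ι φ h (tmul ι a m) = φ a m := by
  rfl

/-- The `A`-linear map `a ⊗ m ↦ a • f m` out of `A ⊗_R M` given by an `R`-linear map `f` from `M`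
to the `A`-module `N`. -/
noncomputable def desc {N : Type*} [AddCommGroup N] [Module A N] (f : M →+ N)
    (hf : ∀ (r : R) (m : M), f (r • m) = ι r • f m) : inducedModule ι M →ₗ[A] N :=
  let φ : A →+ M →+ N := AddMonoidHom.mk' (fun a => (DistribSMul.toAddMonoidHom N a).comp f)
    fun a b => by ext m; exact add_smul a b (f m)
  have hφ (a : A) (r : R) (m : M) : φ (a * ι r) m = φ a (r • m) := by
    change (a * ι r) • f m = a • f (r • m)
    rw [hf, mul_smul]
  { toFun := lift ι φ hφ
    map_add' := map_add _
    map_smul' := fun b z => by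
      induction z using induction_on with
      | h_tmul a m =>
        rw [smul_tmul, lift_tmul, lift_tmul]
        exact mul_smul b a (f m)
      | h_add y z hy hz => rw [smul_add, map_add, hy, hz, map_add, smul_add] }

variable {ι} in
lemma addHom_ext {N : Type*} [AddCommGroup N] {f g : inducedModule ι M →+ N}
    (h : ∀ a m, f (tmul ι a m) = g (tmul ι a m)) : f = g := by
  ext z
  induction z using induction_on with
  | h_tmul a m => exact h a m
  | h_add y z hy hz => rw [map_add, map_add, hy, hz]

variable {ι} in
lemma hom_ext {N : ModuleCat.{max v w} A} {f g : inducedModule ι M ⟶ N}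
    (h : ∀ a m, f.hom (tmul ι a m) = g.hom (tmul ι a m)) : f = g := by
  refine ModuleCat.hom_ext (LinearMap.toAddMonoidHom_injective (addHom_ext h))

/-- The class of `a ⊗ m` in `A ⊗_R N` for an element `m` of an `A`-module `N`. -/
noncomputable def restrictTmul {N : ModuleCat.{w} A} (a : A) (m : N) :
    inducedModule ι ((ModuleCat.restrictScalars ι).obj N) :=
  tmul ι (M := (ModuleCat.restrictScalars ι).obj N) a m

section RestrictTmul

variable {N : ModuleCat.{w} A}

lemma restrictTmul_add (a : A) (m n : N) :
    restrictTmul ι a (m + n) = restrictTmul ι a m + restrictTmul ι a n :=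
  tmul_add ι (M := (ModuleCat.restrictScalars ι).obj N) a m n

lemma restrictTmul_sum {κ : Type*} (s : Finset κ) (a : A) (m : κ → N) :
    restrictTmul ι a (∑ i ∈ s, m i) = ∑ i ∈ s, restrictTmul ι a (m i) :=
  map_sum (AddMonoidHom.mk' (restrictTmul ι a) (restrictTmul_add ι a)) m s

lemma sum_restrictTmul {κ : Type*} (s : Finset κ) (a : κ → A) (m : N) :
    restrictTmul ι (∑ i ∈ s, a i) m = ∑ i ∈ s, restrictTmul ι (a i) m :=
  sum_tmul ι (M := (ModuleCat.restrictScalars ι).obj N) s a m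

lemma mul_restrictTmul (a : A) (r : R) (m : N) :
    restrictTmul ι (a * ι r) m = restrictTmul ι a (ι r • m) :=
  mul_tmul ι (M := (ModuleCat.restrictScalars ι).obj N) a r m

/-- The Casimir element `∑ i, xᵢ ⊗ yᵢ` of a Frobenius system commutes with the elements of `A`. -/
lemma casimir {n : ℕ} {x y : Fin n → A} {τ : A → R}
    (hxy : ∀ a : A, ∑ i, x i * ι (τ (y i * a)) = a ∧ ∑ i, ι (τ (a * x i)) * y i = a)
    (a : A) (m : N) :
    ∑ i, restrictTmul ι (a * x i) (y i • m) = ∑ i, restrictTmul ι (x i) (y i • a • m) := by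
  have h₁ (i : Fin n) : restrictTmul ι (a * x i) (y i • m) =
      ∑ j, restrictTmul ι (x j) ((ι (τ (y j * a * x i)) * y i) • m) := by
    conv_lhs => rw [← (hxy (a * x i)).1]
    rw [sum_restrictTmul]
    refine Finset.sum_congr rfl fun j _ => ?_
    rw [mul_restrictTmul, mul_smul, mul_assoc]
  simp_rw [h₁]
  rw [Finset.sum_comm]
  refine Finset.sum_congr rfl fun j _ => ?_
  rw [← restrictTmul_sum, ← Finset.sum_smul, (hxy (y j * a)).2, mul_smul]

end RestrictTmul

/-- The additive map `a ⊗ m ↦ τ(a) m` from `A ⊗_R M` to `M`. -/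
noncomputable def trace (τ : A →+ R) (hτ : ∀ a r, τ (a * ι r) = τ a * r) :
    inducedModule ι M →+ M :=
  lift ι (AddMonoidHom.mk' (fun a => DistribSMul.toAddMonoidHom M (τ a)) fun a b => by
      ext m
      simp [add_smul])
    fun a r m => by simp [hτ, mul_smul]

lemma trace_tmul (τ : A →+ R) (hτ : ∀ a r, τ (a * ι r) = τ a * r) (a : A) (m : M) :
    trace ι τ hτ (tmul ι a m) = τ a • m := rfl

lemma trace_smul (τ : A →+ R) (hτ : ∀ a r, τ (a * ι r) = τ a * r)
    (hτ' : ∀ r a, τ (ι r * a) = r * τ a) (r : R) (z : inducedModule ι M) :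
    trace ι τ hτ (ι r • z) = r • trace ι τ hτ z := by
  induction z using induction_on with
  | h_tmul a m => rw [smul_tmul, trace_tmul, trace_tmul, hτ', mul_smul]
  | h_add y z hy hz => rw [smul_add, map_add, hy, hz, map_add, smul_add]

end inducedModule

open inducedModule

/-- The adjunction isomorphism `Hom_A(A ⊗_R M, N) ≃ Hom_R(M, N)`. -/
noncomputable def inducedHomEquiv (M : ModuleCat.{max u v w} R) (N : ModuleCat.{max u v w} A) :
    ((inducedModule ι M : ModuleCat.{max u v w} A) ⟶ N) ≃
      (M ⟶ (ModuleCat.restrictScalars.{max u v w} ι).obj N) where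
  toFun g := ModuleCat.ofHom (Y := (ModuleCat.restrictScalars.{max u v w} ι).obj N)
    { toFun := fun m => g.hom (tmul ι 1 m)
      map_add' := fun m n => by rw [tmul_add]; exact map_add g.hom _ _
      map_smul' := fun r m => by
        rw [← mul_tmul, one_mul, ← mul_one (ι r), ← smul_tmul]
        exact map_smul g.hom (ι r) (tmul ι 1 m) }
  invFun f := ModuleCat.ofHom (X := inducedModule ι M) (Y := N)
    (desc ι (N := N) f.hom.toAddMonoidHom fun r m => map_smul f.hom r m)
  left_inv g := by
    refine hom_ext fun a m => ?_
    change a • g.hom (tmul ι 1 m) = _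
    rw [← map_smul, smul_tmul, mul_one]
  right_inv f := by
    ext m
    exact one_smul A (show N from f.hom m)

/-- The induction functor `A ⊗_R -` from `R`-modules to `A`-modules. -/
noncomputable def inducedFunctor : ModuleCat.{max u v w} R ⥤ ModuleCat.{max u v w} A :=
  Adjunction.leftAdjointOfEquiv (G := ModuleCat.restrictScalars.{max u v w} ι)
    (F_obj := fun M => inducedModule ι M) (inducedHomEquiv.{u, v, w} ι) fun _ _ _ _ _ => rfl

/-- Induction is left adjoint to restriction of scalars. -/
noncomputable def inducedRestrictAdjunction :
    inducedFunctor.{u, v, w} ι ⊣ ModuleCat.restrictScalars.{max u v w} ι :=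
  Adjunction.adjunctionOfEquivLeft (inducedHomEquiv.{u, v, w} ι) fun _ _ _ _ _ => rfl

lemma inducedFunctor_map_tmul {M N : ModuleCat.{max u v w} R} (f : M ⟶ N) (a : A) (m : M) :
    ((inducedFunctor.{u, v, w} ι).map f).hom (tmul ι a m) = tmul ι a (f.hom m) := by
  change a • tmul ι 1 (f.hom m) = _
  rw [smul_tmul, mul_one]

variable {ι} in
/-- For a Frobenius extension, induction is also right adjoint to restriction of scalars: the unit
is `n ↦ ∑ i, xᵢ ⊗ yᵢ n` and the counit is `a ⊗ m ↦ τ(a) m`. -/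
theorem IsFrobeniusExtension.nonempty_restrictInducedAdjunction (hι : IsFrobeniusExtension ι) :
    Nonempty (ModuleCat.restrictScalars.{max u v w} ι ⊣ inducedFunctor.{u, v, w} ι) := by
  obtain ⟨τ, hτ, n, x, y, hxy⟩ := hι.exists_frobenius_system
  have hτl (r : R) (a : A) : τ (ι r * a) = r * τ a := by simpa using hτ r a 1
  have hτr (a : A) (r : R) : τ (a * ι r) = τ a * r := by simpa using hτ 1 a r
  let U := ModuleCat.restrictScalars.{max u v w} ι
  let F := inducedFunctor.{u, v, w} ι
  let η (N : ModuleCat.{max u v w} A) : N ⟶ F.obj (U.obj N) :=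
    ModuleCat.ofHom (X := N) (Y := inducedModule ι (U.obj N))
      { toFun := fun m => ∑ i, restrictTmul ι (x i) (y i • m)
        map_add' := fun m m' => by
          simp only [smul_add, restrictTmul_add, Finset.sum_add_distrib]
        map_smul' := fun a m => by
          rw [← casimir ι hxy, RingHom.id_apply]
          exact (Finset.smul_sum (r := a) (s := Finset.univ)
            (f := fun i => restrictTmul ι (x i) (y i • m))).symm }
  let ε (M : ModuleCat.{max u v w} R) : U.obj (F.obj M) ⟶ M :=
    ModuleCat.ofHom (X := U.obj (inducedModule ι M)) (Y := M)
      { toFun := trace ι τ hτr (M := M)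
        map_add' := map_add (trace ι τ hτr (M := M))
        map_smul' := trace_smul ι τ hτr hτl }
  exact ⟨{
    unit :=
      { app := η
        naturality := fun N N' f => by
          ext m
          change ∑ i, restrictTmul ι (x i) (y i • f.hom m) =
            (F.map (U.map f)).hom (∑ i, restrictTmul ι (x i) (y i • m))
          refine Eq.trans ?_ (map_sum (F.map (U.map f)).hom _ _).symm
          refine Finset.sum_congr rfl fun i _ => ?_
          refine Eq.trans ?_ (inducedFunctor_map_tmul ι (U.map f) (x i) (y i • m)).symm
          rw [← map_smul]
          rfl }
    counit :=
      { app := ε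
        naturality := fun M M' f => by
          refine ModuleCat.hom_ext (LinearMap.toAddMonoidHom_injective
            (addHom_ext (ι := ι) (M := M) fun a m => ?_))
          change trace ι τ hτr (((inducedFunctor.{u, v, w} ι).map f).hom (tmul ι a m)) =
            f.hom (trace ι τ hτr (tmul ι a m))
          rw [inducedFunctor_map_tmul, trace_tmul, trace_tmul, map_smul] }
    left_triangle_components := fun N => by
      ext m
      change trace ι τ hτr (M := U.obj N) (∑ i, restrictTmul ι (x i) (y i • m)) = m
      refine (map_sum (trace ι τ hτr (M := U.obj N)) _ _).trans ?_
      have h (m : N) : ∑ i, ι (τ (x i)) • y i • m = m := by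
        simp only [← mul_smul]
        rw [← Finset.sum_smul, show ∑ i, ι (τ (x i)) * y i = 1 by simpa using (hxy 1).2, one_smul]
      exact h m
    right_triangle_components := fun M => by
      refine hom_ext (M := M) fun a m => ?_
      change (F.map (ε M)).hom (∑ i, restrictTmul (N := inducedModule ι M) ι (x i)
        (y i • tmul ι a m)) = tmul ι a m
      refine (map_sum (F.map (ε M)).hom _ _).trans ?_
      have (i : Fin n) : (F.map (ε M)).hom (restrictTmul (N := inducedModule ι M) ι (x i)
          (y i • tmul ι a m)) = tmul ι (x i * ι (τ (y i * a))) m := by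
        rw [mul_tmul]
        exact inducedFunctor_map_tmul ι (ε M) _ _
      refine (Finset.sum_congr rfl fun i _ => this i).trans ?_
      exact (sum_tmul ι _ _ m).symm.trans (congrArg (tmul ι · m) (hxy a).1) }⟩

end Induction

/-- Let `R ⊂ A` be a Frobenius extension and `M` a left `A`-module. Then the `R`-module `M`, the
`A`-module `A ⊗_R M` and the `R`-module `A ⊗_R M` have the same Gorenstein projective dimension,
and the same Gorenstein injective dimension. -/
theorem proposition3p2 {R : Type u} {A : Type v} [Ring R] [Ring A] (ι : R →+* A)
    (hι : IsFrobeniusExtension ι) (M : ModuleCat.{max u v w} A) :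
    (gorensteinProjectiveDim ((ModuleCat.restrictScalars ι).obj M) =
        gorensteinProjectiveDim (inducedModule ι ((ModuleCat.restrictScalars ι).obj M)) ∧
      gorensteinProjectiveDim (inducedModule ι ((ModuleCat.restrictScalars ι).obj M)) =
        gorensteinProjectiveDim ((ModuleCat.restrictScalars ι).obj
          (inducedModule ι ((ModuleCat.restrictScalars ι).obj M)))) ∧
    (gorensteinInjectiveDim ((ModuleCat.restrictScalars ι).obj M) =
        gorensteinInjectiveDim (inducedModule ι ((ModuleCat.restrictScalars ι).obj M)) ∧
      gorensteinInjectiveDim (inducedModule ι ((ModuleCat.restrictScalars ι).obj M)) =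
        gorensteinInjectiveDim ((ModuleCat.restrictScalars ι).obj
          (inducedModule ι ((ModuleCat.restrictScalars ι).obj M)))) := by
  obtain ⟨adj⟩ := hι.nonempty_restrictInducedAdjunction.{u, v, max u v w}
  have : EnoughProjectives (ModuleCat.{max u v w} R) := inferInstance
  have : EnoughInjectives (ModuleCat.{max u v w} R) := ModuleCat.enoughInjectives.{max u v w} R
  exact ⟨gorensteinProjectiveDim_eq_of_adjunctions (inducedRestrictAdjunction.{u, v, w} ι) adj M,
    gorensteinInjectiveDim_eq_of_adjunctions (inducedRestrictAdjunction.{u, v, w} ι) adj M⟩
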